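/- A signed graph is a finite graph (loops and parallel edges allowed) in which each edge has a sign $+$ or $-$. An orientation of a signed graph directs each of the two half-edges of every edge either to or from its end-vertex, so that on a positive edge exactly one of the two half-edges is directed to its end-vertex, while on a negative edge either both or none are. An integer flow $\phi$ assigns to the edges an orientation together with integers $\phi(e)$ such that at each vertex the sum of the incoming values equals the sum of the outgoing values, taken over half-edges; it is nowhere-zero if $\phi(e)\ne 0$ for every edge $e$. A circuit (a loop and a pair of parallel edges being circuits of length $1$ and $2$) is balanced if it has an even number of negative edges and unbalanced otherwise. A signed circuit is a subgraph that is (1) a balanced circuit, or (2) the union of two vertex-disjoint unbalanced circuits with a path joining them that meets the circuits only at its ends, or (3) the union of two unbalanced circuits whose intersection is a single vertex. A signed circuit cover of $G$ is a collection of signed circuits of $G$ such that every edge of $G$ belongs to at least one of them. Corollary. If a signed graph $G$ has a nowhere-zero integer flow $\phi$, then $G$ has a signed circuit cover such that each edge $e$ of $G$ belongs to at most $2|\phi(e)|$ signed circuits of the cover. -/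

import Mathlib

open scoped Graph

/-- A signed graph: a multigraph (loops and parallel edges allowed) each of whose edges
carries a sign `1` or `-1`.  Signs of members of `β` that are not edges are irrelevant. -/
structure SignedGraph (α β : Type*) extends Graph α β where
  sign : β → ℤˣ

namespace SignedGraph

variable {α β : Type*}

/-- An orientation (bidirection) of a signed graph.  Each edge `e` has two half-edges `(e, 0)` and
`(e, 1)`; `vertex e i` is the end-vertex of `(e, i)`, and `dir e i` is `1` if `(e, i)` is directed
to its end-vertex and `-1` if it is directed from it.  A positive edge has exactly one half-edge
directed to its end-vertex; on a negative edge both are directed to, or both are directed from,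
their end-vertices. -/
structure Orientation (G : SignedGraph α β) where
  vertex : E(G.toGraph) → Fin 2 → α
  isLink : ∀ e : E(G.toGraph), G.toGraph.IsLink e (vertex e 0) (vertex e 1)
  dir : E(G.toGraph) → Fin 2 → ℤˣ
  compat_pos : ∀ e : E(G.toGraph), G.sign e = 1 → dir e 0 ≠ dir e 1
  compat_neg : ∀ e : E(G.toGraph), G.sign e = -1 → dir e 0 = dir e 1

/-- Sum of the values on the half-edges at `v` whose direction is `s`: for `s = 1` the sum of
incoming values, for `s = -1` the sum of outgoing values.  A loop at `v` contributes both of its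
half-edges.  (Used for graphs with finitely many edges.) -/
noncomputable def Orientation.flowAt {G : SignedGraph α β} {A : Type*} [AddCommGroup A]
    (O : G.Orientation) (φ : E(G.toGraph) → A) (s : ℤˣ) (v : α) : A :=
  ∑ᶠ h : {h : E(G.toGraph) × Fin 2 // O.vertex h.1 h.2 = v ∧ O.dir h.1 h.2 = s}, φ h.1.1

/-- `φ` together with the orientation `O` is an `A`-flow: Kirchhoff's law holds at each vertex. -/
def IsFlow {A : Type*} [AddCommGroup A] (G : SignedGraph α β) (O : G.Orientation)
    (φ : E(G.toGraph) → A) : Prop :=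
  ∀ v ∈ V(G.toGraph), O.flowAt φ 1 v = O.flowAt φ (-1) v

/-- A flow all of whose values are nonzero. -/
def IsNowhereZeroFlow {A : Type*} [AddCommGroup A] (G : SignedGraph α β) (O : G.Orientation)
    (φ : E(G.toGraph) → A) : Prop :=
  G.IsFlow O φ ∧ ∀ e, φ e ≠ 0

/-- The graph `C` is a circuit: it consists of distinct vertices `v 0, …, v n` and distinct edges
`e 0, …, e n` with `e i` joining `v i` to `v (i + 1)`, indices being taken modulo `n + 1`
(a loop if `n = 0`, two parallel edges if `n = 1`). -/
def IsCircuit (C : Graph α β) : Prop :=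
  ∃ (n : ℕ) (v : Fin (n + 1) → α) (e : Fin (n + 1) → β),
    Function.Injective v ∧ Function.Injective e ∧
    (∀ i, C.IsLink (e i) (v i) (v (i + 1))) ∧
    V(C) = Set.range v ∧ E(C) = Set.range e

/-- The graph `P` is a path (possibly a single vertex) with ends `x` and `y`. -/
def IsPath (P : Graph α β) (x y : α) : Prop :=
  ∃ (n : ℕ) (v : Fin (n + 1) → α) (e : Fin n → β),
    Function.Injective v ∧
    (∀ i : Fin n, P.IsLink (e i) (v i.castSucc) (v i.succ)) ∧
    V(P) = Set.range v ∧ E(P) = Set.range e ∧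
    v 0 = x ∧ v (Fin.last n) = y

/-- `C` is a balanced circuit of `G`: it has an even number of negative edges. -/
def IsBalancedCircuit (G : SignedGraph α β) (C : Graph α β) : Prop :=
  C ≤ G.toGraph ∧ IsCircuit C ∧ Even {e ∈ E(C) | G.sign e = -1}.ncard

/-- `C` is an unbalanced circuit of `G`: it has an odd number of negative edges. -/
def IsUnbalancedCircuit (G : SignedGraph α β) (C : Graph α β) : Prop :=
  C ≤ G.toGraph ∧ IsCircuit C ∧ Odd {e ∈ E(C) | G.sign e = -1}.ncard

/-- The subgraph `C` of `G` is the union of two vertex-disjoint unbalanced circuits and a path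
that joins them and meets the circuits only at its ends. -/
def IsLongBicircuit (G : SignedGraph α β) (C : Graph α β) : Prop :=
  C ≤ G.toGraph ∧ ∃ (C₁ C₂ P : Graph α β) (x y : α),
    G.IsUnbalancedCircuit C₁ ∧ G.IsUnbalancedCircuit C₂ ∧ Disjoint V(C₁) V(C₂) ∧
    P ≤ G.toGraph ∧ IsPath P x y ∧ V(P) ∩ V(C₁) = {x} ∧ V(P) ∩ V(C₂) = {y} ∧
    V(C) = V(C₁) ∪ V(P) ∪ V(C₂) ∧ E(C) = E(C₁) ∪ E(P) ∪ E(C₂)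

/-- The subgraph `C` of `G` is the union of two unbalanced circuits whose intersection is a single
vertex (in particular the two circuits have no common edge, which matters for loops). -/
def IsTightBicircuit (G : SignedGraph α β) (C : Graph α β) : Prop :=
  C ≤ G.toGraph ∧ ∃ (C₁ C₂ : Graph α β) (x : α),
    G.IsUnbalancedCircuit C₁ ∧ G.IsUnbalancedCircuit C₂ ∧
    V(C₁) ∩ V(C₂) = {x} ∧ Disjoint E(C₁) E(C₂) ∧
    V(C) = V(C₁) ∪ V(C₂) ∧ E(C) = E(C₁) ∪ E(C₂)

/-- `C` is a signed circuit of `G`. -/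
def IsSignedCircuit (G : SignedGraph α β) (C : Graph α β) : Prop :=
  G.IsBalancedCircuit C ∨ G.IsLongBicircuit C ∨ G.IsTightBicircuit C

/-- A collection of signed circuits of `G` such that each edge of `G` is in at least one member. -/
def IsSignedCircuitCover (G : SignedGraph α β) (𝒞 : Set (Graph α β)) : Prop :=
  (∀ C ∈ 𝒞, G.IsSignedCircuit C) ∧ ∀ e ∈ E(G.toGraph), ∃ C ∈ 𝒞, e ∈ E(C)

end SignedGraph

/-! Reversing the edges with negative value makes the flow nonnegative, so let `φ` take values in
`ℕ`. Consider walks that pass through each vertex consistently with the orientation; their state is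
a vertex with the direction of the half-edge by which it is left. Kirchhoff's law lets a walk using
each edge at most `φ e` times be extended until it returns to its initial state
(`IsWalk.exists_extension`), so there is a shortest nonempty closed one. It repeats no state, hence
visits a vertex at most twice, in opposite directions. Two such pairs of visits never interlace:
otherwise one arc followed by the reverse of another would be a shorter closed walk
(`exists_reducedTour`).

If the tour repeats no vertex, it is a balanced circuit. Otherwise its innermost closed pieces
(leaves) are unbalanced circuits, and two cyclically consecutive leaves with the stretch between
them form a bicircuit (`Next.isSignedCircuit`). At any time at least one and at most two of these
bicircuits are being traversed (`exists_pair`), so an edge traversed `m e` times lies in at most `2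
* m e` of them (`exists_cover`). The multiplicities `m` satisfy Kirchhoff's law, so `φ - m` does
too, and induction on the sum of `φ` finishes (`exists_signedCircuit_cover`). -/

lemma image_Ico_eq_range {γ : Type*} (f : ℤ → γ) (a : ℤ) (n : ℕ) :
    f '' Set.Ico a (a + n) = Set.range fun i : Fin n => f (a + (i : ℕ)) := by
  ext x
  constructor
  · rintro ⟨k, hk, rfl⟩
    have := hk.1; have := hk.2
    refine ⟨⟨(k - a).toNat, by lia⟩, ?_⟩
    simp only
    congr 1; lia
  · rintro ⟨i, rfl⟩
    exact ⟨_, ⟨by lia, by have := i.2; lia⟩, rfl⟩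

namespace SignedGraph

variable {α β : Type*} {G : SignedGraph α β}

/-! ### States of a consistent traversal -/

namespace Orientation

/-- The state in which a traversal starting with the half-edge `d` leaves: its end-vertex and
its direction. -/
def src (O : G.Orientation) (d : E(G.toGraph) × Fin 2) : α × ℤˣ :=
  (O.vertex d.1 d.2, O.dir d.1 d.2)

/-- The same edge traversed backwards. -/
def flip (d : E(G.toGraph) × Fin 2) : E(G.toGraph) × Fin 2 := (d.1, d.2.rev)

/-- The state in which a consistent traversal has to go on after the traversal of an edge
that starts with the half-edge `d`. -/
def tgt (O : G.Orientation) (d : E(G.toGraph) × Fin 2) : α × ℤˣ :=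
  (O.vertex d.1 d.2.rev, -O.dir d.1 d.2.rev)

lemma eq_or_eq_flip {d d' : E(G.toGraph) × Fin 2} (h : d.1 = d'.1) : d = d' ∨ d = flip d' := by
  obtain ⟨e, i⟩ := d
  obtain ⟨e', j⟩ := d'
  obtain rfl : e = e' := h
  simp only [flip, Prod.mk.injEq, true_and]
  revert i j
  decide

lemma src_flip (O : G.Orientation) (d : E(G.toGraph) × Fin 2) :
    O.src (flip d) = ((O.tgt d).1, -(O.tgt d).2) := by
  simp [src, tgt, flip]

lemma tgt_flip (O : G.Orientation) (d : E(G.toGraph) × Fin 2) :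
    O.tgt (flip d) = ((O.src d).1, -(O.src d).2) := by
  simp [src, tgt, flip]

lemma isLink_src_tgt (O : G.Orientation) (d : E(G.toGraph) × Fin 2) :
    G.toGraph.IsLink d.1 (O.src d).1 (O.tgt d).1 := by
  obtain ⟨e, i⟩ := d
  fin_cases i
  · exact O.isLink e
  · exact (O.isLink e).symm

lemma dir_mul_dir (O : G.Orientation) (e : E(G.toGraph)) :
    O.dir e 0 * O.dir e 1 = -G.sign e := by
  have h1 := O.compat_pos e
  have h2 := O.compat_neg e
  rcases Int.units_eq_one_or (G.sign e) with h | h <;>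
  rcases Int.units_eq_one_or (O.dir e 0) with h0 | h0 <;>
  rcases Int.units_eq_one_or (O.dir e 1) with h1 | h1 <;> simp_all

lemma sign_eq (O : G.Orientation) (d : E(G.toGraph) × Fin 2) :
    G.sign d.1 = (O.src d).2 * (O.tgt d).2 := by
  obtain ⟨e, i⟩ := d
  have := O.dir_mul_dir e
  fin_cases i
  · simp [src, tgt, this]
  · simp [src, tgt, mul_comm, this]

/-- A closed consistent walk that repeats no state and whose repeated vertices do not cross,
written as a periodic sequence of half-edges. -/
structure ReducedTour (O : G.Orientation) where
  dart : ℤ → E(G.toGraph) × Fin 2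
  len : ℤ
  len_pos : 0 < len
  periodic : Function.Periodic dart len
  chain : ∀ k, O.tgt (dart k) = O.src (dart (k + 1))
  src_ne : ∀ i j, i < j → j < i + len → O.src (dart i) ≠ O.src (dart j)
  noncrossing : ∀ i k j l, i < k → k < j → j < l → l < i + len →
    (O.src (dart i)).1 = (O.src (dart j)).1 → (O.src (dart k)).1 ≠ (O.src (dart l)).1

/-! ### Circuits and paths cut out of a tour -/

namespace ReducedTour

variable {O : G.Orientation} (T : O.ReducedTour)

/-- The vertex at time `k`. -/
def pt (k : ℤ) : α := (O.src (T.dart k)).1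

/-- The direction in which the vertex at time `k` is left. -/
def sgn (k : ℤ) : ℤˣ := (O.src (T.dart k)).2

/-- The edge traversed between the times `k` and `k + 1`. -/
def edge (k : ℤ) : β := (T.dart k).1

lemma dart_add (k t : ℤ) : T.dart (k + t * T.len) = T.dart k := by
  simpa using (T.periodic.int_mul t) k

lemma pt_add (k t : ℤ) : T.pt (k + t * T.len) = T.pt k := by
  simp [pt, dart_add]

lemma edge_add (k t : ℤ) : T.edge (k + t * T.len) = T.edge k := by
  simp [edge, dart_add]

lemma pt_add_len (k : ℤ) : T.pt (k + T.len) = T.pt k := by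
  simpa using T.pt_add k 1

lemma sgn_add_len (k : ℤ) : T.sgn (k + T.len) = T.sgn k := by
  simp only [sgn, T.periodic k]

lemma isLink (k : ℤ) : G.toGraph.IsLink (T.edge k) (T.pt k) (T.pt (k + 1)) := by
  have := O.isLink_src_tgt (T.dart k)
  rwa [T.chain] at this

lemma sign_edge (k : ℤ) : G.sign (T.edge k) = T.sgn k * T.sgn (k + 1) := by
  rw [edge, O.sign_eq, T.chain]; rfl

lemma sgn_ne {i j : ℤ} (hij : i < j) (hj : j < i + T.len) (h : T.pt i = T.pt j) :
    T.sgn i ≠ T.sgn j :=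
  fun h' => T.src_ne i j hij hj (Prod.ext h h')

lemma sgn_eq_neg {i j : ℤ} (hij : i < j) (hj : j < i + T.len) (h : T.pt i = T.pt j) :
    T.sgn j = -T.sgn i :=
  Int.units_ne_iff_eq_neg.1 (T.sgn_ne hij hj h).symm

lemma edge_eq_cases {k l : ℤ} (h : T.edge k = T.edge l) :
    (T.pt k = T.pt l ∧ T.sgn k = T.sgn l) ∨
    (T.pt k = T.pt (l + 1) ∧ T.sgn k = -T.sgn (l + 1) ∧
      T.pt (k + 1) = T.pt l ∧ T.sgn (k + 1) = -T.sgn l) := by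
  rcases eq_or_eq_flip (Subtype.ext h) with h | h
  · left
    simp [pt, sgn, h]
  · right
    have h1 := O.src_flip (T.dart l)
    have h2 := O.tgt_flip (T.dart l)
    rw [← h, T.chain] at h1 h2
    simp [pt, sgn, h1, h2]

/-- The subgraph traversed between the times `a` and `b`. -/
def segment (a b : ℤ) : Graph α β where
  vertexSet := T.pt '' Set.Icc a b
  IsLink e x y := e ∈ T.edge '' Set.Ico a b ∧ G.toGraph.IsLink e x y
  edgeSet := T.edge '' Set.Ico a b
  isLink_symm e _ := ⟨fun x y h => ⟨h.1, h.2.symm⟩⟩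
  eq_or_eq_of_isLink_of_isLink _ _ _ _ _ h h' := h.2.left_eq_or_eq h'.2
  edge_mem_iff_exists_isLink e := by
    refine ⟨fun h => ?_, fun ⟨x, y, h⟩ => h.1⟩
    obtain ⟨k, hk, rfl⟩ := h
    exact ⟨_, _, ⟨k, hk, rfl⟩, T.isLink k⟩
  left_mem_of_isLink := by
    rintro _ x y ⟨⟨k, hk, rfl⟩, h⟩
    rcases h.left_eq_or_eq (T.isLink k) with rfl | rfl
    · exact ⟨k, ⟨hk.1, hk.2.le⟩, rfl⟩
    · exact ⟨k + 1, ⟨hk.1.trans (by lia), hk.2⟩, rfl⟩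

lemma vertexSet_segment (a b : ℤ) : V(T.segment a b) = T.pt '' Set.Icc a b := rfl

lemma edgeSet_segment (a b : ℤ) : E(T.segment a b) = T.edge '' Set.Ico a b := rfl

lemma segment_le (a b : ℤ) : T.segment a b ≤ G.toGraph where
  vertexSet_mono := by
    rintro _ ⟨k, -, rfl⟩
    exact (T.isLink k).left_mem
  isLink_mono _ _ _ h := h.2

lemma segment_isLink {a b k : ℤ} (hk : k ∈ Set.Ico a b) :
    (T.segment a b).IsLink (T.edge k) (T.pt k) (T.pt (k + 1)) :=
  ⟨⟨k, hk, rfl⟩, T.isLink k⟩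

lemma segment_add (a b t : ℤ) :
    T.segment (a + t * T.len) (b + t * T.len) = T.segment a b := by
  have h1 : T.edge '' Set.Ico (a + t * T.len) (b + t * T.len) = T.edge '' Set.Ico a b := by
    rw [← Set.image_add_const_Ico, Set.image_image]
    simp [edge_add]
  have h2 : T.pt '' Set.Icc (a + t * T.len) (b + t * T.len) = T.pt '' Set.Icc a b := by
    rw [← Set.image_add_const_Icc, Set.image_image]
    simp [pt_add]
  refine Graph.ext h2 fun e x y => ?_
  change _ ∧ _ ↔ _ ∧ _
  rw [h1]

lemma image_Icc_eq_image_Ico {a b : ℤ} (hab : a < b) (h : T.pt a = T.pt b) :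
    T.pt '' Set.Icc a b = T.pt '' Set.Ico a b := by
  refine subset_antisymm ?_ (Set.image_mono Set.Ico_subset_Icc_self)
  rintro _ ⟨k, hk, rfl⟩
  rcases hk.2.lt_or_eq with h' | rfl
  · exact ⟨k, ⟨hk.1, h'⟩, rfl⟩
  · exact ⟨a, ⟨le_rfl, hab⟩, h⟩

/-- A repeated edge in the same direction repeats its starting vertex. In the opposite direction it
would force a state to equal its own negative, unless both times are the last one. -/
lemma edge_injOn {a b : ℤ} (h : T.pt a = T.pt b) (hinj : Set.InjOn T.pt (Set.Ico a b)) :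
    Set.InjOn T.edge (Set.Ico a b) := by
  intro k hk l hl hkl
  have hab : a ∈ Set.Ico a b := ⟨le_rfl, hk.1.trans_lt hk.2⟩
  rcases T.edge_eq_cases hkl with ⟨h1, -⟩ | ⟨h1, h2, h3, h4⟩
  · exact hinj hk hl h1
  · rcases (show l + 1 ≤ b from hl.2).lt_or_eq with hl' | hl'
    · rw [hinj hk ⟨by have := hl.1; lia, hl'⟩ h1] at h2
      exact absurd h2 (units_ne_neg_self _)
    · rw [hl', ← h] at h1
      have hka := hinj hk hab h1
      rcases (show k + 1 ≤ b from hk.2).lt_or_eq with hk' | hk'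
      · rw [hinj ⟨by have := hk.1; lia, hk'⟩ hl h3] at h4
        exact absurd h4 (units_ne_neg_self _)
      · lia

lemma isCircuit_segment {a b : ℤ} (hab : a < b) (h : T.pt a = T.pt b)
    (hinj : Set.InjOn T.pt (Set.Ico a b)) : IsCircuit (T.segment a b) := by
  obtain ⟨n, rfl⟩ : ∃ n : ℕ, b = a + (n + 1 : ℕ) := ⟨(b - a - 1).toNat, by lia⟩
  have hmem : ∀ i : Fin (n + 1), a + (i : ℕ) ∈ Set.Ico a (a + (n + 1 : ℕ)) :=
    fun i => ⟨by lia, by have := i.2; lia⟩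
  refine ⟨n, fun i => T.pt (a + (i : ℕ)), fun i => T.edge (a + (i : ℕ)), ?_, ?_, ?_, ?_, ?_⟩
  · intro i j hij
    have := hinj (hmem i) (hmem j) hij
    ext; lia
  · intro i j hij
    have := T.edge_injOn h hinj (hmem i) (hmem j) hij
    ext; lia
  · intro i
    have := T.segment_isLink (hmem i)
    convert this using 1
    rcases Fin.eq_castSucc_or_eq_last i with ⟨j, rfl⟩ | rfl
    · simp [Fin.coeSucc_eq_succ, add_assoc]
    · simpa [add_assoc] using h
  · rw [vertexSet_segment, T.image_Icc_eq_image_Ico hab h, image_Ico_eq_range]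
  · rw [edgeSet_segment, image_Ico_eq_range]

lemma isPath_segment {a b : ℤ} (hab : a ≤ b) (hinj : Set.InjOn T.pt (Set.Icc a b)) :
    IsPath (T.segment a b) (T.pt a) (T.pt b) := by
  obtain ⟨n, rfl⟩ : ∃ n : ℕ, b = a + n := ⟨(b - a).toNat, by lia⟩
  have hmem : ∀ i : Fin (n + 1), a + (i : ℕ) ∈ Set.Icc a (a + n) := fun i => by
    have h := i.2
    constructor
    · lia
    · generalize (i : ℕ) = m at h
      lia
  refine ⟨n, fun i => T.pt (a + (i : ℕ)), fun i => T.edge (a + (i : ℕ)), ?_, ?_, ?_, ?_, ?_, ?_⟩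
  · intro i j hij
    have := hinj (hmem i) (hmem j) hij
    ext; lia
  · intro i
    have := T.segment_isLink (a := a) (b := a + n) (k := a + (i : ℕ))
      ⟨by lia, by have := i.2; lia⟩
    simpa [add_assoc] using this
  · rw [vertexSet_segment, ← image_Ico_eq_range]
    congr 1
    ext k
    simp only [Set.mem_Icc, Set.mem_Ico]
    lia
  · rw [edgeSet_segment, image_Ico_eq_range]
  · simp
  · simp

/-- By `sign_edge` the product telescopes. -/
lemma prod_sign {a b : ℤ} (hab : a ≤ b) :
    ∏ k ∈ Finset.Ico a b, G.sign (T.edge k) = T.sgn a * T.sgn b := by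
  induction b, hab using Int.leInduction with
  | base => simp
  | succ b hb ih =>
    rw [← Finset.insert_Ico_right_eq_Ico_add_one hb, Finset.prod_insert (by simp), ih, sign_edge]
    rw [mul_comm (T.sgn b) (T.sgn (b + 1)), mul_comm (T.sgn a) (T.sgn b), mul_assoc,
      ← mul_assoc (T.sgn b), Int.units_mul_self, one_mul, mul_comm]

/-- Balance of a closed segment is thus read off from its two end directions: equal means balanced,
opposite means unbalanced. -/
lemma neg_one_pow_ncard {a b : ℤ} (hab : a ≤ b) (hinj : Set.InjOn T.edge (Set.Ico a b)) :
    (-1 : ℤˣ) ^ {e ∈ E(T.segment a b) | G.sign e = -1}.ncard = T.sgn a * T.sgn b := by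
  classical
  have h : {e ∈ E(T.segment a b) | G.sign e = -1} =
      T.edge '' ({k ∈ Finset.Ico a b | G.sign (T.edge k) = -1} : Finset ℤ) := by
    ext e
    simp only [edgeSet_segment, Finset.coe_filter, Finset.mem_Ico]
    constructor
    · rintro ⟨⟨k, hk, rfl⟩, h⟩
      exact ⟨k, ⟨hk, h⟩, rfl⟩
    · rintro ⟨k, ⟨hk, h⟩, rfl⟩
      exact ⟨⟨k, hk, rfl⟩, h⟩
  rw [h, Set.InjOn.ncard_image (hinj.mono fun k hk => by simpa using (Finset.mem_filter.1 hk).1),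
    Set.ncard_coe_finset, ← T.prod_sign hab, ← Finset.prod_const, Finset.prod_filter]
  refine Finset.prod_congr rfl fun k _ => ?_
  rcases Int.units_eq_one_or (G.sign (T.edge k)) with h | h <;> simp [h]
-- Leaves and the bicircuits formed by consecutive leaves
/-- Between the times `a` and `b` the tour traverses an unbalanced circuit. -/
structure Leaf (a b : ℤ) : Prop where
  lt : a < b
  lt_add : b < a + T.len
  pt_eq : T.pt a = T.pt b
  injOn : Set.InjOn T.pt (Set.Ico a b)

/-- The leaf `a' b'` is the first one after the leaf `a b`. -/
structure Next (a b a' b' : ℤ) : Prop where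
  fst : T.Leaf a b
  snd : T.Leaf a' b'
  le : b ≤ a'
  injOn : Set.InjOn T.pt (Set.Ico b b')

variable {T}

lemma Leaf.add {a b : ℤ} (h : T.Leaf a b) (t : ℤ) :
    T.Leaf (a + t * T.len) (b + t * T.len) where
  lt := by have := h.lt; lia
  lt_add := by have := h.lt_add; lia
  pt_eq := by rw [T.pt_add, T.pt_add, h.pt_eq]
  injOn := by
    intro k hk l hl hkl
    have := @h.injOn (k + -t * T.len) ⟨by have := hk.1; lia, by have := hk.2; lia⟩
      (l + -t * T.len) ⟨by have := hl.1; lia, by have := hl.2; lia⟩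
      (by rw [T.pt_add, T.pt_add, hkl])
    lia

lemma Next.add {a b a' b' : ℤ} (h : T.Next a b a' b') (t : ℤ) :
    T.Next (a + t * T.len) (b + t * T.len) (a' + t * T.len) (b' + t * T.len) where
  fst := h.fst.add t
  snd := h.snd.add t
  le := by have := h.le; lia
  injOn := by
    intro k hk l hl hkl
    have := @h.injOn (k + -t * T.len) ⟨by have := hk.1; lia, by have := hk.2; lia⟩
      (l + -t * T.len) ⟨by have := hl.1; lia, by have := hl.2; lia⟩
      (by rw [T.pt_add, T.pt_add, hkl])
    lia

variable (T)

/-- The earliest time `b` whose vertex was already seen since `i` closes a piece without inner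
repetitions; leaves are found in this way. -/
lemma exists_first_return {i j : ℤ} (hij : i < j) (h : ¬ Set.InjOn T.pt (Set.Icc i j)) :
    ∃ a b, i ≤ a ∧ a < b ∧ b ≤ j ∧ T.pt a = T.pt b ∧ Set.InjOn T.pt (Set.Ico i b) := by
  obtain ⟨b, ⟨hib, hb⟩, hmin⟩ := Int.exists_least_of_bdd
    (P := fun x => i ≤ x ∧ ¬ Set.InjOn T.pt (Set.Icc i x)) ⟨i, fun _ hx => hx.1⟩ ⟨j, hij.le, h⟩
  have hinj : Set.InjOn T.pt (Set.Ico i b) := by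
    by_contra hcon
    have hsub : Set.Ico i b ⊆ Set.Icc i (b - 1) := fun k hk => ⟨hk.1, by have := hk.2; lia⟩
    by_cases hb' : i ≤ b - 1
    · have := hmin (b - 1) ⟨hb', fun h' => hcon (h'.mono hsub)⟩
      lia
    · exact hcon fun k hk l hl _ => by have := hk.1; have := hk.2; lia
  have key : ∃ a ∈ Set.Ico i b, T.pt a = T.pt b := by
    by_contra! hcon
    refine hb fun k hk l hl hkl => ?_
    rcases hk.2.lt_or_eq with hk' | rfl <;> rcases hl.2.lt_or_eq with hl' | rfl
    · exact hinj ⟨hk.1, hk'⟩ ⟨hl.1, hl'⟩ hkl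
    · exact absurd hkl (hcon k ⟨hk.1, hk'⟩)
    · exact absurd hkl.symm (hcon l ⟨hl.1, hl'⟩)
    · rfl
  obtain ⟨a, ha, hab⟩ := key
  exact ⟨a, b, ha.1, ha.2, hmin j ⟨hij.le, h⟩, hab, hinj⟩

lemma exists_leaf (h : ¬ Set.InjOn T.pt (Set.Ico 0 T.len)) : ∃ a b, T.Leaf a b := by
  have hsub : Set.Ico 0 T.len ⊆ Set.Icc 0 (T.len - 1) := fun k hk => ⟨hk.1, by have := hk.2; lia⟩
  have hlen : 0 < T.len - 1 := by
    by_contra hcon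
    exact h fun k hk l hl _ => by
      have := hk.1; have := hk.2; have := hl.1; have := hl.2; lia
  obtain ⟨a, b, h1, h2, h3, h4, h5⟩ := T.exists_first_return hlen fun h' => h (h'.mono hsub)
  exact ⟨a, b, h2, by lia, h4, h5.mono (Set.Ico_subset_Ico_left h1)⟩

variable {T}

lemma Leaf.exists_next {a b : ℤ} (h : T.Leaf a b) : ∃ a' b', T.Next a b a' b' := by
  have hlt := h.lt
  have hlt' := h.lt_add
  -- The search ends by `a + T.len`, where the vertex of time `b` recurs.
  obtain ⟨a', b', h1, h2, h3, h4, h5⟩ := T.exists_first_return (i := b) (j := a + T.len) hlt' (by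
    intro hinj
    have := hinj ⟨le_rfl, hlt'.le⟩ ⟨hlt'.le, le_rfl⟩ (by rw [T.pt_add_len, h.pt_eq])
    lia)
  exact ⟨a', b', h, ⟨h2, by lia, h4, h5.mono (Set.Ico_subset_Ico_left h1)⟩, h1, h5⟩

lemma Next.le_add_len {a b a' b' : ℤ} (h : T.Next a b a' b') : b' ≤ a + T.len := by
  by_contra! hcon
  have := h.injOn ⟨le_rfl, by have := h.le; have := h.snd.lt; lia⟩ ⟨h.fst.lt_add.le, hcon⟩
    (by rw [T.pt_add_len, h.fst.pt_eq])
  have := h.fst.lt_add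
  lia

/-- Vertices inside a leaf are visited only once in a period. -/
lemma Leaf.pt_ne {a b k l : ℤ} (h : T.Leaf a b) (hk : k ∈ Set.Ioo a b)
    (hl : l ∈ Set.Icc b (a + T.len)) : T.pt k ≠ T.pt l := by
  intro hkl
  have ha : T.pt a ≠ T.pt k := fun h' => by
    have := h.injOn ⟨le_rfl, h.lt⟩ ⟨hk.1.le, hk.2⟩ h'
    have := hk.1
    lia
  rcases hl.1.lt_or_eq with hl1 | rfl
  · rcases hl.2.lt_or_eq with hl2 | rfl
    -- The pair `k`, `l` would interlace with the pair `a`, `b`.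
    · exact T.noncrossing a k b l hk.1 hk.2 hl1 hl2 h.pt_eq hkl
    · exact ha (by rw [hkl, T.pt_add_len])
  · exact ha (by rw [hkl, h.pt_eq])

lemma Leaf.isUnbalancedCircuit {a b : ℤ} (h : T.Leaf a b) :
    G.IsUnbalancedCircuit (T.segment a b) := by
  refine ⟨T.segment_le a b, T.isCircuit_segment h.lt h.pt_eq h.injOn, ?_⟩
  have h1 := T.neg_one_pow_ncard h.lt.le (T.edge_injOn h.pt_eq h.injOn)
  rw [T.sgn_eq_neg h.lt h.lt_add h.pt_eq, mul_neg, Int.units_mul_self] at h1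
  by_contra hcon
  rw [Nat.not_odd_iff_even] at hcon
  rw [hcon.neg_one_pow] at h1
  exact absurd h1 (by decide)

variable (T) in
lemma isBalancedCircuit (h : Set.InjOn T.pt (Set.Ico 0 T.len)) :
    G.IsBalancedCircuit (T.segment 0 T.len) := by
  have hpt : T.pt 0 = T.pt T.len := by simpa using (T.pt_add_len 0).symm
  have hsgn : T.sgn T.len = T.sgn 0 := by simpa using T.sgn_add_len 0
  refine ⟨T.segment_le _ _, T.isCircuit_segment T.len_pos hpt h, ?_⟩
  have h1 := T.neg_one_pow_ncard T.len_pos.le (T.edge_injOn hpt h)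
  rw [hsgn, Int.units_mul_self] at h1
  by_contra hcon
  rw [Nat.not_even_iff_odd] at hcon
  rw [hcon.neg_one_pow] at h1
  exact absurd h1 (by decide)

/-- The second leaf ends within a period of `a`, so `Leaf.pt_ne` leaves only the attachment vertex
of the first leaf. -/
lemma Next.mem_vertexSet_inter {a b a' b' k l : ℤ} (h : T.Next a b a' b')
    (hk : k ∈ Set.Icc a b) (hl : l ∈ Set.Icc b b') (hkl : T.pt k = T.pt l) : T.pt k = T.pt a := by
  rcases hk.1.lt_or_eq with h1 | rfl
  · rcases hk.2.lt_or_eq with h2 | rfl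
    · exact absurd hkl (h.fst.pt_ne ⟨h1, h2⟩ ⟨hl.1, hl.2.trans h.le_add_len⟩)
    · exact h.fst.pt_eq.symm
  · rfl

lemma Next.isTightBicircuit {a b b' : ℤ} (h : T.Next a b b b') :
    G.IsTightBicircuit (T.segment a b') := by
  have hab := h.fst.lt
  have hbb := h.snd.lt
  have hbn := h.le_add_len
  refine ⟨T.segment_le _ _, T.segment a b, T.segment b b', T.pt b, h.fst.isUnbalancedCircuit,
    h.snd.isUnbalancedCircuit, ?_, ?_, ?_, ?_⟩
  · refine subset_antisymm ?_ (Set.singleton_subset_iff.2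
      ⟨⟨b, ⟨hab.le, le_rfl⟩, rfl⟩, ⟨b, ⟨le_rfl, hbb.le⟩, rfl⟩⟩)
    rintro _ ⟨⟨k, hk, rfl⟩, ⟨l, hl, hkl⟩⟩
    exact (h.mem_vertexSet_inter hk hl hkl.symm).trans h.fst.pt_eq
  · rw [Set.disjoint_left]
    rintro _ ⟨k, hk, rfl⟩ ⟨l, hl, hkl⟩
    have hk1 := hk.1
    have hk2 := hk.2
    have hl1 := hl.1
    have hl2 := hl.2
    rcases T.edge_eq_cases hkl.symm with ⟨h1, h2⟩ | ⟨h1, h2, h3, h4⟩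
    · exact T.sgn_ne (by lia) (by lia) h1 h2
    -- A common edge traversed backwards has both ends at the shared vertex, so it is traversed at
    -- the successive times `a` and `b = a + 1`; the state at `b` would then be its own negative.
    · have hka : k = a := by
        have := h.mem_vertexSet_inter ⟨hk1, hk2.le⟩ ⟨by lia, by lia⟩ h1
        exact h.fst.injOn hk ⟨le_rfl, hab⟩ this
      have hkb := h.mem_vertexSet_inter ⟨by lia, hk2⟩ ⟨hl1, hl2.le⟩ h3
      have hlb : l = b := h.injOn hl ⟨le_rfl, hbb⟩ (by rw [← h3, hkb, h.fst.pt_eq])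
      have hkb' : k + 1 = b := by
        by_contra hne
        have := h.fst.injOn ⟨by lia, by lia⟩ ⟨le_rfl, hab⟩ hkb
        lia
      rw [hkb', hlb] at h4
      exact units_ne_neg_self _ h4
  · simp only [vertexSet_segment]
    rw [← Set.image_union, Set.Icc_union_Icc_eq_Icc hab.le hbb.le]
  · simp only [edgeSet_segment]
    rw [← Set.image_union, Set.Ico_union_Ico_eq_Ico hab.le hbb.le]

lemma Next.isLongBicircuit {a b a' b' : ℤ} (h : T.Next a b a' b') (hba : b < a') :
    G.IsLongBicircuit (T.segment a b') := by
  have hab := h.fst.lt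
  have hab' := h.snd.lt
  have hbn := h.le_add_len
  refine ⟨T.segment_le _ _, T.segment a b, T.segment a' b', T.segment b a', T.pt b, T.pt a',
    h.fst.isUnbalancedCircuit, h.snd.isUnbalancedCircuit, ?_, T.segment_le _ _,
    T.isPath_segment hba.le (h.injOn.mono (Set.Icc_subset_Ico_right hab')), ?_, ?_, ?_, ?_⟩
  · rw [Set.disjoint_left]
    rintro _ ⟨k, hk, rfl⟩ hl
    rw [vertexSet_segment, T.image_Icc_eq_image_Ico hab' h.snd.pt_eq] at hl
    obtain ⟨l, hl, hkl⟩ := hl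
    have hl1 := hl.1
    have h1 := h.mem_vertexSet_inter hk ⟨hba.le.trans hl.1, hl.2.le⟩ hkl.symm
    have := h.injOn ⟨hba.le.trans hl.1, hl.2⟩ ⟨le_rfl, hba.trans hab'⟩
      (by rw [hkl, h1, h.fst.pt_eq])
    lia
  · refine subset_antisymm ?_ (Set.singleton_subset_iff.2
      ⟨⟨b, ⟨le_rfl, hba.le⟩, rfl⟩, ⟨b, ⟨hab.le, le_rfl⟩, rfl⟩⟩)
    rintro _ ⟨⟨l, hl, hkl⟩, ⟨k, hk, rfl⟩⟩
    exact (h.mem_vertexSet_inter hk ⟨hl.1, hl.2.trans hab'.le⟩ hkl.symm).trans h.fst.pt_eq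
  · refine subset_antisymm ?_ (Set.singleton_subset_iff.2
      ⟨⟨a', ⟨hba.le, le_rfl⟩, rfl⟩, ⟨a', ⟨le_rfl, hab'.le⟩, rfl⟩⟩)
    rintro _ ⟨⟨k, hk, rfl⟩, hl⟩
    rw [vertexSet_segment, T.image_Icc_eq_image_Ico hab' h.snd.pt_eq] at hl
    obtain ⟨l, hl, hkl⟩ := hl
    have := h.injOn ⟨hba.le.trans hl.1, hl.2⟩ ⟨hk.1, hk.2.trans_lt hab'⟩ hkl
    have : k = a' := by have := hl.1; have := hk.2; lia
    exact congrArg T.pt this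
  · simp only [vertexSet_segment]
    rw [← Set.image_union, ← Set.image_union, Set.Icc_union_Icc_eq_Icc hab.le hba.le,
      Set.Icc_union_Icc_eq_Icc (hab.trans hba).le hab'.le]
  · simp only [edgeSet_segment]
    rw [← Set.image_union, ← Set.image_union, Set.Ico_union_Ico_eq_Ico hab.le hba.le,
      Set.Ico_union_Ico_eq_Ico (hab.trans hba).le hab'.le]

lemma Next.isSignedCircuit {a b a' b' : ℤ} (h : T.Next a b a' b') :
    G.IsSignedCircuit (T.segment a b') := by
  rcases h.le.lt_or_eq with h' | rfl
  · exact Or.inr (Or.inl (h.isLongBicircuit h'))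
  · exact Or.inr (Or.inr h.isTightBicircuit)

/-! ### Cyclic order of the leaves and the cover of a tour -/

lemma Leaf.left_unique {a₁ a₂ b : ℤ} (h₁ : T.Leaf a₁ b) (h₂ : T.Leaf a₂ b) : a₁ = a₂ := by
  have key : ∀ {a₁ a₂ : ℤ}, T.Leaf a₁ b → T.Leaf a₂ b → ¬ a₁ < a₂ := by
    intro a₁ a₂ h₁ h₂ hlt
    have := h₁.injOn ⟨le_rfl, h₁.lt⟩ ⟨hlt.le, h₂.lt⟩ (by rw [h₁.pt_eq, h₂.pt_eq])
    lia
  exact le_antisymm (not_lt.1 (key h₂ h₁)) (not_lt.1 (key h₁ h₂))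

/-- Overlapping leaves would either nest, against injectivity on the larger one, or interlace,
against `Leaf.pt_ne`. -/
lemma Leaf.le_of_lt {a₁ b₁ a₂ b₂ : ℤ} (h₁ : T.Leaf a₁ b₁) (h₂ : T.Leaf a₂ b₂) (h : b₁ < b₂) :
    b₁ ≤ a₂ := by
  by_contra! hcon
  have h2 := h₂.lt_add
  rcases lt_trichotomy a₁ a₂ with h' | rfl | h'
  · refine h₁.pt_ne (k := a₂) (l := b₂) ⟨h', hcon⟩ ⟨h.le, ?_⟩ h₂.pt_eq
    by_contra! hlt
    have := h₂.injOn (x₁ := a₁ + T.len) (x₂ := b₁) ⟨by have := h₁.lt_add; lia, hlt⟩ ⟨hcon.le, h⟩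
      (by rw [T.pt_add_len, h₁.pt_eq])
    have := h₁.lt_add
    lia
  · have := h₂.injOn ⟨le_rfl, h₂.lt⟩ ⟨hcon.le, h⟩ h₁.pt_eq
    lia
  · have := h₂.injOn ⟨h'.le, h₁.lt.trans h⟩ ⟨hcon.le, h⟩ h₁.pt_eq
    have := h₁.lt
    lia

lemma Next.le_of_lt {a b a' b' c d : ℤ} (h : T.Next a b a' b') (h' : T.Leaf c d) (hd : b < d) :
    b' ≤ d := by
  by_contra! hcon
  have := h.injOn ⟨h.fst.le_of_lt h' hd, h'.lt.trans hcon⟩ ⟨hd.le, hcon⟩ h'.pt_eq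
  have := h'.lt
  lia

/-- Hence the bicircuits are indexed by the end `b` of their first leaf. -/
lemma Next.right_unique {a b a' b' c c' d' : ℤ} (h : T.Next a b a' b') (h' : T.Next c b c' d') :
    a = c ∧ a' = c' ∧ b' = d' := by
  have h1 := h.fst.left_unique h'.fst
  have h2 : b' = d' := le_antisymm
    (h.le_of_lt h'.snd (h'.le.trans_lt h'.snd.lt)) (h'.le_of_lt h.snd (h.le.trans_lt h.snd.lt))
  subst h2
  exact ⟨h1, h.snd.left_unique h'.snd, rfl⟩

/-- At most two of the bicircuits formed by consecutive leaves, and at least one of them, are being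
traversed at any time. -/
lemma exists_pair {a₀ b₀ : ℤ} (h₀ : T.Leaf a₀ b₀) (k : ℤ) :
    ∃ X Y : Graph α β,
      (∃ a b a' b', T.Next a b a' b' ∧ k ∈ Set.Ico a b' ∧ X = T.segment a b') ∧
      ∀ a b a' b', T.Next a b a' b' → k ∈ Set.Ico a b' →
        T.segment a b' = X ∨ T.segment a b' = Y := by
  -- `m` is the last leaf end up to time `k`. Only the leaf ending at `m` and its successor can be
  -- the first leaf of a bicircuit traversed at time `k`.
  obtain ⟨m, ⟨⟨a, hm⟩, hmk⟩, hmax⟩ := Int.exists_greatest_of_bdd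
    (P := fun m => (∃ a, T.Leaf a m) ∧ m ≤ k) ⟨k, fun _ h => h.2⟩ (by
      refine ⟨b₀ + -|b₀ - k| * T.len, ⟨_, h₀.add _⟩, ?_⟩
      have h1 := le_abs_self (b₀ - k)
      have h2 := T.len_pos
      nlinarith [abs_nonneg (b₀ - k)])
  obtain ⟨a', b', h1⟩ := hm.exists_next
  obtain ⟨a'', b'', h2⟩ := h1.snd.exists_next
  have hkb' : k < b' := by
    by_contra! hcon
    have := hmax b' ⟨⟨_, h1.snd⟩, hcon⟩
    have := h1.le
    have := h1.snd.lt
    lia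
  refine ⟨T.segment a b', T.segment a' b'', ⟨a, m, a', b', h1, ⟨hm.lt.le.trans hmk, hkb'⟩, rfl⟩, ?_⟩
  intro c d c' d' h hk
  rcases le_or_gt d k with hd | hd
  · have hdm := hmax d ⟨⟨_, h.fst⟩, hd⟩
    have : d = m := by
      by_contra hne
      have := h.le_of_lt hm (by lia)
      have := hk.2
      lia
    subst this
    obtain ⟨rfl, -, rfl⟩ := h.right_unique h1
    exact Or.inl rfl
  · have hbd : b' ≤ d := h1.le_of_lt h.fst (hmk.trans_lt hd)
    have : d = b' := by
      by_contra hne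
      have := h1.snd.le_of_lt h.fst (by lia)
      have := hk.1
      lia
    subst this
    obtain ⟨rfl, -, rfl⟩ := h.right_unique h2
    exact Or.inr rfl

variable (T) in
theorem exists_cover [DecidableEq β] : ∃ 𝒞 : Set (Graph α β), 𝒞.Finite ∧
    (∀ C ∈ 𝒞, G.IsSignedCircuit C) ∧ (∀ k, ∃ C ∈ 𝒞, T.edge k ∈ E(C)) ∧
    ∀ e, {C ∈ 𝒞 | e ∈ E(C)}.ncard ≤ 2 * {k ∈ Finset.Ico 0 T.len | T.edge k = e}.card := by
  have hmod : ∀ k, k + -(k / T.len) * T.len ∈ Finset.Ico 0 T.len := fun k => by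
    have h1 := Int.emod_nonneg k T.len_pos.ne'
    have h2 := Int.emod_lt_of_pos k T.len_pos
    rw [Int.emod_def] at h1 h2
    rw [Finset.mem_Ico]
    constructor <;> linarith [mul_comm T.len (k / T.len)]
  by_cases hinj : Set.InjOn T.pt (Set.Ico 0 T.len)
  · refine ⟨{T.segment 0 T.len}, Set.finite_singleton _, ?_, fun k => ⟨_, rfl, ?_⟩, fun e => ?_⟩
    · rintro _ rfl
      exact Or.inl (T.isBalancedCircuit hinj)
    · exact ⟨_, Finset.mem_Ico.1 (hmod k), T.edge_add _ _⟩
    · by_cases he : e ∈ E(T.segment 0 T.len)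
      · obtain ⟨k, hk, rfl⟩ := he
        have h1 : 0 < {l ∈ Finset.Ico 0 T.len | T.edge l = T.edge k}.card :=
          Finset.card_pos.2 ⟨k, Finset.mem_filter.2 ⟨Finset.mem_Ico.2 hk, rfl⟩⟩
        have h2 := Set.ncard_le_ncard
          (Set.sep_subset {T.segment 0 T.len} fun C => T.edge k ∈ E(C)) (Set.finite_singleton _)
        rw [Set.ncard_singleton] at h2
        lia
      · rw [Set.sep_eq_empty_iff_mem_false.2 (by rintro _ rfl; exact he), Set.ncard_empty]
        exact Nat.zero_le _
  · obtain ⟨a₀, b₀, h₀⟩ := T.exists_leaf hinj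
    choose X Y hX hXY using exists_pair h₀
    classical
    -- Shifting by whole periods does not change a segment, so only `X` and `Y` at times in one
    -- period matter.
    have hshift : ∀ {a b a' b' k}, T.Next a b a' b' → k ∈ Set.Ico a b' →
        T.segment a b' = X (k + -(k / T.len) * T.len) ∨
        T.segment a b' = Y (k + -(k / T.len) * T.len) := by
      intro a b a' b' k h hk
      rw [← T.segment_add a b' (-(k / T.len))]
      exact hXY _ _ _ _ _ (h.add _) ⟨by have := hk.1; lia, by have := hk.2; lia⟩
    refine ⟨{C | ∃ a b a' b', T.Next a b a' b' ∧ C = T.segment a b'}, ?_, ?_, fun k => ?_,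
      fun e => ?_⟩
    · refine ((Finset.Ico 0 T.len).image X ∪ (Finset.Ico 0 T.len).image Y).finite_toSet.subset ?_
      rintro _ ⟨a, b, a', b', h, rfl⟩
      have hk : a ∈ Set.Ico a b' := ⟨le_rfl, by
        have := h.fst.lt; have := h.le; have := h.snd.lt; lia⟩
      rw [Finset.mem_coe, Finset.mem_union, Finset.mem_image, Finset.mem_image]
      exact (hshift h hk).imp (fun h' => ⟨_, hmod _, h'.symm⟩) fun h' => ⟨_, hmod _, h'.symm⟩
    · rintro _ ⟨a, b, a', b', h, rfl⟩
      exact h.isSignedCircuit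
    · obtain ⟨a, b, a', b', h, hk, -⟩ := hX k
      exact ⟨_, ⟨a, b, a', b', h, rfl⟩, ⟨k, hk, rfl⟩⟩
    · set S := {k ∈ Finset.Ico 0 T.len | T.edge k = e} with hS
      have hsub : {C ∈ {C | ∃ a b a' b', T.Next a b a' b' ∧ C = T.segment a b'} | e ∈ E(C)} ⊆
          (S.image X ∪ S.image Y : Finset (Graph α β)) := by
        rintro _ ⟨⟨a, b, a', b', h, rfl⟩, ⟨k, hk, rfl⟩⟩
        have hmem : k + -(k / T.len) * T.len ∈ S :=
          Finset.mem_filter.2 ⟨hmod k, T.edge_add _ _⟩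
        rw [Finset.mem_coe, Finset.mem_union, Finset.mem_image, Finset.mem_image]
        exact (hshift h hk).imp (fun h' => ⟨_, hmem, h'.symm⟩) fun h' => ⟨_, hmem, h'.symm⟩
      calc _ ≤ _ := Set.ncard_le_ncard hsub (Finset.finite_toSet _)
        _ = _ := Set.ncard_coe_finset _
        _ ≤ _ := Finset.card_union_le _ _
        _ ≤ S.card + S.card := add_le_add Finset.card_image_le Finset.card_image_le
        _ = 2 * S.card := (two_mul _).symm

end ReducedTour
-- Consistent walks, multiplicities and Kirchhoff's law
variable {O : G.Orientation}

/-- The list `l` is a consistent walk from the state `x` to the state `y`. -/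
def IsWalk (O : G.Orientation) (x : α × ℤˣ) : List (E(G.toGraph) × Fin 2) → α × ℤˣ → Prop
  | [], y => x = y
  | d :: l, y => O.src d = x ∧ O.IsWalk (O.tgt d) l y

lemma isWalk_append {x z : α × ℤˣ} {l₁ l₂ : List (E(G.toGraph) × Fin 2)} :
    O.IsWalk x (l₁ ++ l₂) z ↔ ∃ y, O.IsWalk x l₁ y ∧ O.IsWalk y l₂ z := by
  induction l₁ generalizing x with
  | nil => simp [IsWalk]
  | cons d l ih => simp [IsWalk, ih, and_assoc]

lemma isWalk_singleton (d : E(G.toGraph) × Fin 2) : O.IsWalk (O.src d) [d] (O.tgt d) :=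
  ⟨rfl, rfl⟩

lemma IsWalk.reverse {x y : α × ℤˣ} {l : List (E(G.toGraph) × Fin 2)} (h : O.IsWalk x l y) :
    O.IsWalk (y.1, -y.2) (l.map flip).reverse (x.1, -x.2) := by
  induction l generalizing x with
  | nil => obtain rfl : x = y := h; rfl
  | cons d l ih =>
    obtain ⟨rfl, h⟩ := h
    rw [List.map_cons, List.reverse_cons, isWalk_append]
    exact ⟨_, ih h, O.src_flip d, O.tgt_flip d⟩

lemma IsWalk.exists_states {x y : α × ℤˣ} {l : List (E(G.toGraph) × Fin 2)}
    (h : O.IsWalk x l y) : ∃ s : ℕ → α × ℤˣ, s 0 = x ∧ s l.length = y ∧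
      ∀ i (hi : i < l.length), O.src l[i] = s i ∧ O.tgt l[i] = s (i + 1) := by
  induction l generalizing x with
  | nil => exact ⟨fun _ => x, rfl, h, fun i hi => absurd hi (Nat.not_lt_zero i)⟩
  | cons d l ih =>
    obtain ⟨hd, h⟩ := h
    obtain ⟨s, h0, h1, h2⟩ := ih h
    refine ⟨fun i => i.casesOn x s, rfl, h1, fun i hi => ?_⟩
    cases i with
    | zero => exact ⟨hd, h0.symm⟩
    | succ i => exact h2 i (Nat.lt_of_succ_lt_succ hi)

section

variable [DecidableEq E(G.toGraph)]

/-- The number of times a list of half-edges traverses the edge `e`. -/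
def mult (l : List (E(G.toGraph) × Fin 2)) (e : E(G.toGraph)) : ℕ := (l.map Prod.fst).count e

lemma mult_append (l₁ l₂ : List (E(G.toGraph) × Fin 2)) (e : E(G.toGraph)) :
    mult (l₁ ++ l₂) e = mult l₁ e + mult l₂ e := by
  simp [mult]

lemma mult_cons (d : E(G.toGraph) × Fin 2) (l : List (E(G.toGraph) × Fin 2)) (e : E(G.toGraph)) :
    mult (d :: l) e = mult l e + if d.1 = e then 1 else 0 := by
  simp [mult, List.count_cons]

lemma mult_reverse_map_flip (l : List (E(G.toGraph) × Fin 2)) (e : E(G.toGraph)) :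
    mult (l.map flip).reverse e = mult l e := by
  rw [mult, List.map_reverse, List.count_reverse, List.map_map]
  rfl

lemma mult_perm {l₁ l₂ : List (E(G.toGraph) × Fin 2)} (h : l₁.Perm l₂) (e : E(G.toGraph)) :
    mult l₁ e = mult l₂ e :=
  (h.map Prod.fst).count_eq e

lemma sum_mult [Fintype E(G.toGraph)] (l : List (E(G.toGraph) × Fin 2)) : ∑ e, mult l e = l.length := by
  induction l with
  | nil => simp [mult]
  | cons d l ih => simp [mult_cons, Finset.sum_add_distrib, ih]

end

/-- The excess of the values `ψ` at the vertex `v`. -/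
def excess [Fintype E(G.toGraph)] [DecidableEq α] (O : G.Orientation)
    (ψ : E(G.toGraph) → ℤ) (v : α) : ℤ :=
  ∑ e, ∑ i, if O.vertex e i = v then (O.dir e i : ℤ) * ψ e else 0

section

variable [Fintype E(G.toGraph)] [DecidableEq α]

lemma excess_add (ψ₁ ψ₂ : E(G.toGraph) → ℤ) (v : α) :
    O.excess (ψ₁ + ψ₂) v = O.excess ψ₁ v + O.excess ψ₂ v := by
  simp only [excess, ← Finset.sum_add_distrib]
  refine Finset.sum_congr rfl fun e _ => Finset.sum_congr rfl fun i _ => ?_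
  split_ifs <;> simp [mul_add]

lemma excess_sub (ψ₁ ψ₂ : E(G.toGraph) → ℤ) (v : α) :
    O.excess (ψ₁ - ψ₂) v = O.excess ψ₁ v - O.excess ψ₂ v := by
  rw [eq_sub_iff_add_eq, ← excess_add, sub_add_cancel]

variable [DecidableEq E(G.toGraph)]

lemma excess_single (d : E(G.toGraph) × Fin 2) (v : α) :
    O.excess (Pi.single d.1 1) v = (if (O.src d).1 = v then ((O.src d).2 : ℤ) else 0) -
      (if (O.tgt d).1 = v then ((O.tgt d).2 : ℤ) else 0) := by
  rw [excess, Finset.sum_eq_single d.1 (fun e _ he => by simp [Pi.single_eq_of_ne he]) (by simp)]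
  obtain ⟨e, i⟩ := d
  fin_cases i
  · simp only [src, tgt, Fin.sum_univ_two, Pi.single_eq_same, mul_one]
    simp only [Fin.zero_eta, Fin.isValue, Fin.rev_zero, Units.val_neg]
    change _ = (if O.vertex e 0 = v then (O.dir e 0 : ℤ) else 0) -
      if O.vertex e 1 = v then -(O.dir e 1 : ℤ) else 0
    split_ifs <;> simp
  · simp only [src, tgt, Fin.sum_univ_two, Pi.single_eq_same, mul_one, Units.val_neg]
    change _ = (if O.vertex e 1 = v then (O.dir e 1 : ℤ) else 0) -
      if O.vertex e 0 = v then -(O.dir e 0 : ℤ) else 0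
    split_ifs <;> simp [add_comm]

lemma IsWalk.excess_mult {x y : α × ℤˣ} {l : List (E(G.toGraph) × Fin 2)}
    (h : O.IsWalk x l y) (v : α) : O.excess (fun e => (mult l e : ℤ)) v =
      (if x.1 = v then (x.2 : ℤ) else 0) - (if y.1 = v then (y.2 : ℤ) else 0) := by
  induction l generalizing x with
  | nil => obtain rfl : x = y := h; simp [mult, excess]
  | cons d l ih =>
    obtain ⟨rfl, h⟩ := h
    have : (fun e => (mult (d :: l) e : ℤ)) = (fun e => (mult l e : ℤ)) + Pi.single d.1 1 := by
      ext e
      by_cases he : d.1 = e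
      · subst he; simp [mult_cons]
      · simp [mult_cons, he]
    rw [this, excess_add, ih h, excess_single]
    ring

/-- If every half-edge with state `y` were used up, the excess of `φ - mult l` at `y.1`, multiplied
by `y.2`, would be at most `0`. But `IsWalk.excess_mult` makes it `1`, or `2` if the walk starts at
the same vertex in the opposite direction. -/
lemma IsWalk.exists_extension {φ : E(G.toGraph) → ℕ}
    (hφ : ∀ v, O.excess (fun e => (φ e : ℤ)) v = 0) {x y : α × ℤˣ}
    {l : List (E(G.toGraph) × Fin 2)} (h : O.IsWalk x l y) (hl : ∀ e, mult l e ≤ φ e)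
    (hxy : x ≠ y) : ∃ d, O.src d = y ∧ ∀ e, mult (l ++ [d]) e ≤ φ e := by
  by_contra! hcon
  have h0 : ∀ d, O.src d = y → φ d.1 ≤ mult l d.1 := by
    intro d hd
    obtain ⟨e, he⟩ := hcon d hd
    rw [mult_append, mult_cons] at he
    by_cases hde : d.1 = e
    · subst hde
      simp [mult] at he ⊢
      lia
    · have := hl e
      simp [mult, hde] at he this
      lia
  have h1 : O.excess (fun e => (φ e : ℤ) - mult l e) y.1 * y.2 ≤ 0 := by
    rw [excess, Finset.sum_mul]
    refine Finset.sum_nonpos fun e _ => ?_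
    rw [Finset.sum_mul]
    refine Finset.sum_nonpos fun i _ => ?_
    split_ifs with hv
    · by_cases hs : O.dir e i = y.2
      · have h2 := h0 (e, i) (Prod.ext hv hs)
        have h3 := hl e
        rw [show (φ e : ℤ) - mult l e = 0 by simp only at h2; lia]
        simp
      · rw [Int.units_ne_iff_eq_neg.1 hs]
        have h3 := hl e
        rcases Int.units_eq_one_or y.2 with h | h <;> rw [h] <;> simp <;> lia
    · simp
  have h2 := O.excess_sub (fun e => (φ e : ℤ)) (fun e => (mult l e : ℤ)) y.1
  rw [hφ, h.excess_mult, if_pos rfl] at h2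
  change O.excess (fun e => (φ e : ℤ) - mult l e) y.1 = _ at h2
  rw [h2] at h1
  split_ifs at h1 with hv
  · have hs : x.2 = -y.2 := Int.units_ne_iff_eq_neg.1 fun hs => hxy (Prod.ext hv hs)
    rw [hs] at h1
    rcases Int.units_eq_one_or y.2 with h | h <;> rw [h] at h1 <;> simp at h1
  · rcases Int.units_eq_one_or y.2 with h | h <;> rw [h] at h1 <;> simp at h1

lemma exists_closed_isWalk {φ : E(G.toGraph) → ℕ}
    (hφ : ∀ v, O.excess (fun e => (φ e : ℤ)) v = 0) (h0 : φ ≠ 0) :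
    ∃ x l, O.IsWalk x l x ∧ l ≠ [] ∧ ∀ e, mult l e ≤ φ e := by
  by_contra! hcon
  obtain ⟨e₀, he₀⟩ := Function.ne_iff.1 h0
  -- Without a closed walk, extension never stops, but the length is bounded by the sum of `φ`.
  have key : ∀ N : ℕ, ∃ x y l, O.IsWalk x l y ∧ l.length = N + 1 ∧ ∀ e, mult l e ≤ φ e := by
    intro N
    induction N with
    | zero =>
      refine ⟨_, _, _, O.isWalk_singleton (e₀, 0), rfl, fun e => ?_⟩
      by_cases he : e₀ = e
      · subst he
        simpa [mult, Nat.one_le_iff_ne_zero] using he₀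
      · simp [mult, he]
    | succ N ih =>
      obtain ⟨x, y, l, h, hN, hl⟩ := ih
      have hxy : x ≠ y := by
        rintro rfl
        obtain ⟨e, he⟩ := hcon x l h (by rintro rfl; simp at hN)
        exact absurd (hl e) (not_le.2 he)
      obtain ⟨d, rfl, hd⟩ := h.exists_extension hφ hl hxy
      exact ⟨_, _, _, isWalk_append.2 ⟨_, h, O.isWalk_singleton d⟩, by simp [hN], hd⟩
  obtain ⟨x, y, l, -, hN, hl⟩ := key (∑ e, φ e)
  have := Finset.sum_le_sum fun e (_ : e ∈ Finset.univ) => hl e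
  rw [sum_mult] at this
  lia

end

/-! ### A shortest closed walk as a periodic sequence -/

/-- The `m` half-edges with which a sequence leaves the times `i`, …, `i + m - 1`. -/
def window (d : ℤ → E(G.toGraph) × Fin 2) (i : ℤ) (m : ℕ) : List (E(G.toGraph) × Fin 2) :=
  (List.range m).map fun t => d (i + (t : ℕ))

lemma window_succ (d : ℤ → E(G.toGraph) × Fin 2) (i : ℤ) (m : ℕ) :
    window d i (m + 1) = window d i m ++ [d (i + m)] := by
  simp [window, List.range_succ]

lemma window_add (d : ℤ → E(G.toGraph) × Fin 2) (i : ℤ) (m m' : ℕ) :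
    window d i (m + m') = window d i m ++ window d (i + m) m' := by
  simp [window, List.range_add, Function.comp_def, add_assoc]

lemma isWalk_window {d : ℤ → E(G.toGraph) × Fin 2} (hd : ∀ k, O.tgt (d k) = O.src (d (k + 1)))
    (i : ℤ) (m : ℕ) : O.IsWalk (O.src (d i)) (window d i m) (O.src (d (i + m))) := by
  induction m with
  | zero => simp [window, IsWalk]
  | succ m ih =>
    rw [window_succ, isWalk_append]
    refine ⟨_, ih, rfl, ?_⟩
    rw [hd]
    simp [IsWalk, add_assoc]

/-- Moving the start by one step moves one half-edge from the front to the end. So multiplicities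
may be counted from any starting time. -/
lemma window_perm {d : ℤ → E(G.toGraph) × Fin 2} {n : ℕ} (hd : Function.Periodic d (n : ℤ))
    (i : ℤ) : (window d i n).Perm (window d 0 n) := by
  have key : ∀ i, (window d (i + 1) n).Perm (window d i n) := by
    intro i
    have h1 := window_succ d i n
    rw [add_comm n 1, window_add, hd] at h1
    have h2 : window d i 1 = [d i] := by simp [window]
    rw [h2, Nat.cast_one] at h1
    have h3 := List.perm_append_comm (l₁ := window d i n) (l₂ := [d i])
    rw [← h1] at h3
    exact (List.perm_cons _).1 h3
  induction i using Int.induction_on with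
  | zero => exact List.Perm.refl _
  | succ i ih => exact (key i).trans ih
  | pred i ih =>
    have := key (-(i : ℤ) - 1)
    rw [sub_add_cancel] at this
    exact this.symm.trans ih

lemma mult_window [DecidableEq E(G.toGraph)] (d : ℤ → E(G.toGraph) × Fin 2) (m : ℕ)
    (e : E(G.toGraph)) :
    mult (window d 0 m) e = {k ∈ Finset.Ico 0 (m : ℤ) | (d k).1 = e}.card := by
  induction m with
  | zero => simp [mult, window]
  | succ m ih =>
    rw [window_succ, mult_append, ih, Nat.cast_succ,
      ← Finset.insert_Ico_right_eq_Ico_add_one (Int.natCast_nonneg m), Finset.filter_insert]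
    split_ifs with h
    · rw [Finset.card_insert_of_notMem (by simp)]
      simp [mult, h]
    · simp [mult, h]

section

variable [Fintype E(G.toGraph)] [DecidableEq α] [DecidableEq E(G.toGraph)]

theorem exists_reducedTour {φ : E(G.toGraph) → ℕ}
    (hφ : ∀ v, O.excess (fun e => (φ e : ℤ)) v = 0) (h0 : φ ≠ 0) :
    ∃ T : O.ReducedTour, (∀ e, {k ∈ Finset.Ico 0 T.len | (T.dart k).1 = e}.card ≤ φ e) ∧
      ∀ v, O.excess (fun e => ({k ∈ Finset.Ico 0 T.len | (T.dart k).1 = e}.card : ℤ)) v = 0 := by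
  classical
  have hex : ∃ n x l, O.IsWalk x l x ∧ l ≠ [] ∧ (∀ e, mult l e ≤ φ e) ∧ l.length = n := by
    obtain ⟨x, l, h1, h2, h3⟩ := exists_closed_isWalk hφ h0
    exact ⟨_, x, l, h1, h2, h3, rfl⟩
  obtain ⟨x, l, hw, hne, hle, hn⟩ := Nat.find_spec hex
  have hmin : ∀ x' l', O.IsWalk x' l' x' → l' ≠ [] → (∀ e, mult l' e ≤ φ e) →
      l.length ≤ l'.length := fun x' l' h1 h2 h3 => by
    rw [hn]; exact Nat.find_min' hex ⟨x', l', h1, h2, h3, rfl⟩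
  clear hn hex
  have hpos : 0 < l.length := List.length_pos_iff.2 hne
  have hposZ : 0 < (l.length : ℤ) := by exact_mod_cast hpos
  have hmodlt : ∀ k : ℤ, (k % l.length).toNat < l.length := fun k => by
    have := Int.emod_nonneg k hposZ.ne'
    have := Int.emod_lt_of_pos k hposZ
    lia
  set d : ℤ → E(G.toGraph) × Fin 2 := fun k => l[(k % l.length).toNat]'(hmodlt k) with hd
  have hper : Function.Periodic d (l.length : ℤ) := fun k => by simp [hd]
  have hwin : window d 0 l.length = l := by
    refine List.ext_getElem (by simp [window]) fun i h1 h2 => ?_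
    have : ((0 + (i : ℤ)) % l.length).toNat = i := by
      rw [zero_add, ← Int.natCast_mod, Nat.mod_eq_of_lt h2, Int.toNat_natCast]
    simp only [window, List.getElem_map, List.getElem_range, hd, this]
  have hchain : ∀ k, O.tgt (d k) = O.src (d (k + 1)) := by
    intro k
    obtain ⟨s, hs0, hs1, hs⟩ := hw.exists_states
    have h1 := Int.emod_nonneg k hposZ.ne'
    have h2 := Int.emod_lt_of_pos k hposZ
    rw [(hs _ (hmodlt k)).2, (hs _ (hmodlt (k + 1))).1]
    rcases (show k % l.length + 1 ≤ l.length by lia).lt_or_eq with h | h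
    · have : (k + 1) % l.length = k % l.length + 1 := by
        rw [← Int.emod_add_emod, Int.emod_eq_of_lt (by lia) h]
      rw [this]
      congr 1; lia
    -- At the end of a period the step closes up because the walk returns to its initial state.
    · have : (k + 1) % l.length = 0 := by
        rw [← Int.emod_add_emod, h, Int.emod_self]
      rw [this, Int.toNat_zero, hs0, ← hs1]
      congr 1; lia
  have hmult : ∀ i e, mult (window d i l.length) e ≤ φ e := fun i e => by
    rw [mult_perm (window_perm hper i), hwin]
    exact hle e
  have hsrc_ne : ∀ i j : ℤ, i < j → j < i + l.length → O.src (d i) ≠ O.src (d j) := by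
    intro i j hij hj heq
    obtain ⟨m, rfl⟩ : ∃ m : ℕ, j = i + m := ⟨(j - i).toNat, by lia⟩
    have h1 := O.isWalk_window hchain i m
    rw [← heq] at h1
    have h2 := hmin _ _ h1 (by intro h; have := congrArg List.length h; simp [window] at this; lia)
      fun e => by
        have h3 := hmult i e
        rw [show l.length = m + (l.length - m) by lia, window_add, mult_append] at h3
        lia
    simp [window] at h2
    lia
  let T : O.ReducedTour :=
    { dart := d
      len := l.length
      len_pos := hposZ
      periodic := hper
      chain := hchain
      src_ne := hsrc_ne
      noncrossing := by
        intro i k j r hik hkj hjr hr hij hkr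
        obtain ⟨m₁, rfl⟩ : ∃ m : ℕ, k = i + m := ⟨(k - i).toNat, by lia⟩
        obtain ⟨m₂, rfl⟩ : ∃ m : ℕ, j = i + m₁ + m := ⟨(j - (i + m₁)).toNat, by lia⟩
        obtain ⟨m₃, rfl⟩ : ∃ m : ℕ, r = i + m₁ + m₂ + m := ⟨(r - (i + m₁ + m₂)).toNat, by lia⟩
        have hneg : ∀ {a b : ℤ}, a < b → b < a + l.length →
            (O.src (d a)).1 = (O.src (d b)).1 →
            O.src (d a) = ((O.src (d b)).1, -(O.src (d b)).2) := fun h1 h2 h3 =>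
          Prod.ext h3 (Int.units_ne_iff_eq_neg.1 fun h => hsrc_ne _ _ h1 h2 (Prod.ext h3 h))
        -- The states at `i` and `j` are opposite, as are those at `k` and `r`. So the arc from `i`
        -- to `k` followed by the reverse of the arc from `j` to `r` is closed, and it omits the arc
        -- from `k` to `j`.
        have h1 := O.isWalk_window hchain i m₁
        have h2 := (O.isWalk_window hchain (i + m₁ + m₂) m₃).reverse
        rw [← hneg (by lia) (by lia) hij, ← hneg (by lia) (by lia) hkr] at h2
        have h3 := hmin _ _ (isWalk_append.2 ⟨_, h1, h2⟩)
          (by intro h; have := congrArg List.length h; simp [window] at this; lia)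
          fun e => by
            have h3 := hmult i e
            rw [show l.length = m₁ + (m₂ + (m₃ + (l.length - m₁ - m₂ - m₃))) by lia, window_add,
              window_add, window_add, mult_append, mult_append, mult_append] at h3
            rw [mult_append, mult_reverse_map_flip]
            lia
        simp [window] at h3
        lia }
  have hT : ∀ e, {k ∈ Finset.Ico 0 T.len | (T.dart k).1 = e}.card = mult l e := fun e => by
    have := mult_window d l.length e
    rw [hwin] at this
    exact this.symm
  refine ⟨T, fun e => (hT e).trans_le (hle e), fun v => ?_⟩
  simp only [hT]
  rw [hw.excess_mult, sub_self]

theorem exists_signedCircuit_cover (φ : E(G.toGraph) → ℕ)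
    (hφ : ∀ v, O.excess (fun e => (φ e : ℤ)) v = 0) :
    ∃ 𝒞 : Set (Graph α β), 𝒞.Finite ∧ (∀ C ∈ 𝒞, G.IsSignedCircuit C) ∧
      (∀ e, φ e ≠ 0 → ∃ C ∈ 𝒞, (e : β) ∈ E(C)) ∧
      ∀ e : E(G.toGraph), {C ∈ 𝒞 | (e : β) ∈ E(C)}.ncard ≤ 2 * φ e := by
  classical
  induction hN : ∑ e, φ e using Nat.strong_induction_on generalizing φ with
  | _ N ih =>
  by_cases h0 : φ = 0
  · refine ⟨∅, Set.finite_empty, by simp, by simp [h0], by simp⟩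
  obtain ⟨T, hT, hexc⟩ := exists_reducedTour hφ h0
  set m : E(G.toGraph) → ℕ := fun e => {k ∈ Finset.Ico 0 T.len | (T.dart k).1 = e}.card with hm
  have hm0 : ∃ e, 0 < m e := ⟨(T.dart 0).1, Finset.card_pos.2
    ⟨0, Finset.mem_filter.2 ⟨Finset.mem_Ico.2 ⟨le_rfl, T.len_pos⟩, rfl⟩⟩⟩
  have hlt : ∑ e, (φ e - m e) < N := by
    rw [← hN]
    obtain ⟨e, he⟩ := hm0
    exact Finset.sum_lt_sum (fun e _ => Nat.sub_le _ _) ⟨e, Finset.mem_univ _, by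
      have := hT e
      change m e ≤ φ e at this
      lia⟩
  -- The bound is additive: `2 * (φ e - m e)` from the remaining flow and `2 * m e` from the tour.
  obtain ⟨𝒞₁, hfin₁, hc₁, hcov₁, hcard₁⟩ := ih _ hlt (fun e => φ e - m e) (fun v => by
    have h := O.excess_sub (fun e => (φ e : ℤ)) (fun e => (m e : ℤ)) v
    rw [hφ, hexc, sub_zero] at h
    rw [← h]
    congr 1
    ext e
    exact Nat.cast_sub (hT e)) rfl
  obtain ⟨𝒞₂, hfin₂, hc₂, hcov₂, hcard₂⟩ := T.exists_cover
  refine ⟨𝒞₁ ∪ 𝒞₂, hfin₁.union hfin₂, ?_, ?_, ?_⟩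
  · rintro C (hC | hC)
    · exact hc₁ C hC
    · exact hc₂ C hC
  · intro e he
    by_cases hme : m e = 0
    · obtain ⟨C, hC, heC⟩ := hcov₁ e (by rwa [hme, Nat.sub_zero])
      exact ⟨C, Or.inl hC, heC⟩
    · obtain ⟨k, hk⟩ := Finset.card_pos.1 (Nat.pos_of_ne_zero hme)
      obtain ⟨C, hC, heC⟩ := hcov₂ k
      rw [ReducedTour.edge, (Finset.mem_filter.1 hk).2] at heC
      exact ⟨C, Or.inr hC, heC⟩
  · intro e
    have h1 := hcard₁ e
    have h2 := hcard₂ e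
    simp only [ReducedTour.edge, Subtype.val_inj] at h2
    have h3 := hT e
    change _ ≤ 2 * m e at h2
    change m e ≤ φ e at h3
    have h4 : {C ∈ 𝒞₁ ∪ 𝒞₂ | (e : β) ∈ E(C)} =
        {C ∈ 𝒞₁ | (e : β) ∈ E(C)} ∪ {C ∈ 𝒞₂ | (e : β) ∈ E(C)} := Set.union_inter_distrib_right ..
    rw [h4]
    have h5 := Set.ncard_union_le {C ∈ 𝒞₁ | (e : β) ∈ E(C)} {C ∈ 𝒞₂ | (e : β) ∈ E(C)}
    lia

end

/-! ### Reduction to a nonnegative flow -/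

/-- The orientation obtained from `O` by reversing the edges on which `σ` is `-1`. -/
def reorient (O : G.Orientation) (σ : E(G.toGraph) → ℤˣ) : G.Orientation where
  vertex := O.vertex
  isLink := O.isLink
  dir e i := σ e * O.dir e i
  compat_pos e h := by simpa using O.compat_pos e h
  compat_neg e h := by simpa using O.compat_neg e h

lemma excess_eq_flowAt_sub [Fintype E(G.toGraph)] [DecidableEq α] (O : G.Orientation)
    (φ : E(G.toGraph) → ℤ) (v : α) :
    O.excess φ v = O.flowAt φ 1 v - O.flowAt φ (-1) v := by
  classical
  have h : ∀ s : ℤˣ, O.flowAt φ s v =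
      ∑ e, ∑ i, if O.vertex e i = v ∧ O.dir e i = s then φ e else 0 := by
    intro s
    rw [flowAt, finsum_eq_sum_of_fintype, ← Fintype.sum_prod_type', ← Finset.sum_filter]
    exact (Finset.sum_subtype _ (by simp) fun h : E(G.toGraph) × Fin 2 => φ h.1).symm
  rw [h, h, excess, ← Finset.sum_sub_distrib]
  refine Finset.sum_congr rfl fun e _ => ?_
  rw [← Finset.sum_sub_distrib]
  refine Finset.sum_congr rfl fun i _ => ?_
  rcases Int.units_eq_one_or (O.dir e i) with h | h <;> by_cases hv : O.vertex e i = v <;>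
    simp [h, hv, show (1 : ℤˣ) ≠ -1 by decide, show (-1 : ℤˣ) ≠ 1 by decide]

lemma excess_eq_zero_of_notMem [Fintype E(G.toGraph)] [DecidableEq α] (O : G.Orientation)
    (φ : E(G.toGraph) → ℤ) {v : α} (hv : v ∉ V(G.toGraph)) : O.excess φ v = 0 := by
  refine Finset.sum_eq_zero fun e _ => Finset.sum_eq_zero fun i _ => if_neg ?_
  rintro rfl
  exact hv (O.isLink_src_tgt (e, i)).left_mem

end Orientation
end SignedGraph

theorem mainTheorem3 {α β : Type*} (G : SignedGraph α β) (hfin : E(G.toGraph).Finite)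
    (O : G.Orientation) (φ : E(G.toGraph) → ℤ) (hφ : G.IsNowhereZeroFlow O φ) :
    ∃ 𝒞 : Set (Graph α β), 𝒞.Finite ∧ G.IsSignedCircuitCover 𝒞 ∧
      ∀ e : E(G.toGraph), ({C ∈ 𝒞 | (e : β) ∈ E(C)}.ncard : ℤ) ≤ 2 * |φ e| := by
  classical
  have := hfin.fintype
  obtain ⟨hflow, hne⟩ := hφ
  let σ : E(G.toGraph) → ℤˣ := fun e => if 0 ≤ φ e then 1 else -1
  have hσ : ∀ e, (σ e : ℤ) * (φ e).natAbs = φ e := fun e => by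
    by_cases h : 0 ≤ φ e
    · simp [σ, h]
    · simp [σ, h, abs_of_neg (not_le.1 h)]
  have hexc : ∀ v, (O.reorient σ).excess (fun e => ((φ e).natAbs : ℤ)) v = 0 := by
    intro v
    have h1 : (O.reorient σ).excess (fun e => ((φ e).natAbs : ℤ)) v = O.excess φ v := by
      refine Finset.sum_congr rfl fun e _ => Finset.sum_congr rfl fun i _ => ?_
      simp only [SignedGraph.Orientation.reorient, Units.val_mul]
      rw [mul_right_comm, hσ, mul_comm]
      rfl
    rw [h1]
    -- Kirchhoff's law is given only on the vertex set; no half-edge ends elsewhere.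
    by_cases hv : v ∈ V(G.toGraph)
    · rw [O.excess_eq_flowAt_sub, hflow v hv, sub_self]
    · exact O.excess_eq_zero_of_notMem φ hv
  obtain ⟨𝒞, h1, h2, h3, h4⟩ := SignedGraph.Orientation.exists_signedCircuit_cover
    (fun e => (φ e).natAbs) hexc
  refine ⟨𝒞, h1, ⟨h2, fun e he => h3 ⟨e, he⟩ (Int.natAbs_ne_zero.2 (hne _))⟩, fun e => ?_⟩
  have := h4 e
  rw [Int.abs_eq_natAbs]
  exact_mod_cast this
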